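/- Let $A^2=A^2(\mathbb C,e^{-|z|^2})$ be the Segal–Bargmann space of all entire functions $u$ with $\|u\|^2=\int_{\mathbb C}|u(z)|^2e^{-|z|^2}\,d\lambda(z)<\infty$, with inner product $(u,v)=\int_{\mathbb C}u\,\overline v\,e^{-|z|^2}\,d\lambda$, where $\lambda$ is Lebesgue measure on $\mathbb C$. Let $A^2_{(1,0)}$ be the space of $(1,0)$-forms $f\,dz$ with $f\in A^2$, with norm $\|f\,dz\|=\|f\|$. Let $m\ge 0$ be an integer, let $a_0,\dots,a_m\in\mathbb C$ with $a_m\neq 0$, and put $p_m(u)=\sum_{k=0}^m a_k\,\frac{\partial^k u}{\partial z^k}$. Let $D$ be the densely defined operator $Du=p_m(u)\,dz$ from $A^2$ to $A^2_{(1,0)}$ with $\operatorname{dom}(D)=\{u\in A^2: p_m(u)\in A^2\}$, let $D^*$ be its Hilbert space adjoint, and let $\tilde\Box_{D,1}=DD^*$ with $\operatorname{dom}(\tilde\Box_{D,1})=\{f\in\operatorname{dom}(D^*): D^*f\in\operatorname{dom}(D)\}$. Then $\tilde\Box_{D,1}:\operatorname{dom}(\tilde\Box_{D,1})\to A^2_{(1,0)}$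 has a bounded inverse $\tilde N_{D,1}: A^2_{(1,0)}\to\operatorname{dom}(\tilde\Box_{D,1})$; that is, there is a bounded linear operator $\tilde N_{D,1}$ on $A^2_{(1,0)}$ with range in $\operatorname{dom}(\tilde\Box_{D,1})$ such that $\tilde\Box_{D,1}\tilde N_{D,1}\alpha=\alpha$ for all $\alpha\in A^2_{(1,0)}$ and $\tilde N_{D,1}\tilde\Box_{D,1}f=f$ for all $f\in\operatorname{dom}(\tilde\Box_{D,1})$. Moreover $(\ker D)^\perp=\operatorname{im}D^*$, and there is a constant $C>0$ such that for every $\alpha\in A^2_{(1,0)}$ the function $u_0=D^*\tilde N_{D,1}\alpha$ is the canonical solution of $Du=\alpha$: $u_0\in\operatorname{dom}(D)$, $Du_0=\alpha$, $u_0\in(\ker D)^\perp$, and $\|u_0\|\le C\|\alpha\|$. -/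

import Mathlib

open MeasureTheory Filter Topology
open scoped ComplexConjugate

noncomputable section

/-- The Segal–Bargmann space `A²(ℂ, e^{-|z|²})` as a linear subspace of the space of all
functions `ℂ → ℂ`: the entire functions `u` with `∫ |u(z)|² e^{-|z|²} dλ(z) < ∞`. -/
def segalBargmannSubmodule : Submodule ℂ (ℂ → ℂ) where
  carrier := {u | Differentiable ℂ u ∧
    Integrable (fun z : ℂ => ‖u z‖ ^ 2 * Real.exp (-‖z‖ ^ 2)) volume}
  zero_mem' := ⟨differentiable_const _, by simp⟩
  add_mem' := by
    rintro u v ⟨hu, hu'⟩ ⟨hv, hv'⟩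
    refine ⟨hu.add hv, ((hu'.add hv').const_mul 2).mono' ?_ (ae_of_all _ fun z => ?_)⟩
    · have h1 := hu.continuous
      have h2 := hv.continuous
      exact (((h1.add h2).norm.pow 2).mul (by fun_prop)).aestronglyMeasurable
    · have he := Real.exp_pos (-‖z‖ ^ 2)
      rw [Real.norm_of_nonneg (by positivity)]
      have h3 : ‖u z + v z‖ ^ 2 ≤ 2 * (‖u z‖ ^ 2 + ‖v z‖ ^ 2) := by
        have := norm_add_le (u z) (v z)
        nlinarith [norm_nonneg (u z + v z), sq_nonneg (‖u z‖ - ‖v z‖)]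
      simp only [Pi.add_apply]
      nlinarith
  smul_mem' := by
    rintro c u ⟨hu, hu'⟩
    refine ⟨hu.const_smul c, (hu'.const_mul (‖c‖ ^ 2)).congr (ae_of_all _ fun z => ?_)⟩
    simp only [Pi.smul_apply, norm_smul]
    ring

/-- The Segal–Bargmann space `A²(ℂ, e^{-|z|²})` as a type of its own, so that it carries the
Hilbert space topology and not the topology of pointwise convergence. -/
def SegalBargmann : Type := segalBargmannSubmodule

namespace SegalBargmann

instance : AddCommGroup SegalBargmann := inferInstanceAs (AddCommGroup segalBargmannSubmodule)

instance : Module ℂ SegalBargmann := inferInstanceAs (Module ℂ segalBargmannSubmodule)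

/-- The inclusion of the Segal–Bargmann space into the space of all functions. -/
def toFun : SegalBargmann →ₗ[ℂ] (ℂ → ℂ) := segalBargmannSubmodule.subtype

instance : CoeFun SegalBargmann (fun _ => ℂ → ℂ) := ⟨fun u => toFun u⟩

/-- An entire function that is square integrable for the Gaussian weight, as an element. -/
def mk (u : ℂ → ℂ) (hu : u ∈ segalBargmannSubmodule) : SegalBargmann := ⟨u, hu⟩

theorem mk_apply (u : ℂ → ℂ) (hu : u ∈ segalBargmannSubmodule) (z : ℂ) : mk u hu z = u z := rfl

theorem coe_mem (u : SegalBargmann) : (u : ℂ → ℂ) ∈ segalBargmannSubmodule := u.2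

theorem toFun_injective : Function.Injective toFun := Subtype.val_injective

theorem differentiable (u : SegalBargmann) : Differentiable ℂ (u : ℂ → ℂ) := u.2.1

theorem continuous (u : SegalBargmann) : Continuous (u : ℂ → ℂ) := u.2.1.continuous

theorem integrable_normSq (u : SegalBargmann) :
    Integrable (fun z : ℂ => ‖u z‖ ^ 2 * Real.exp (-‖z‖ ^ 2)) volume := u.2.2

theorem add_apply (u v : SegalBargmann) (z : ℂ) : (u + v) z = u z + v z := rfl

theorem sub_apply (u v : SegalBargmann) (z : ℂ) : (u - v) z = u z - v z := rfl

theorem smul_apply (c : ℂ) (u : SegalBargmann) (z : ℂ) : (c • u) z = c * u z := rfl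

theorem integrable_inner (u v : SegalBargmann) :
    Integrable (fun z : ℂ => conj (u z) * v z * (Real.exp (-‖z‖ ^ 2) : ℂ)) volume := by
  refine (u.integrable_normSq.add v.integrable_normSq).mono' ?_ (ae_of_all _ fun z => ?_)
  · have h1 := u.continuous
    have h2 := v.continuous
    exact Continuous.aestronglyMeasurable (by fun_prop)
  · have he := Real.exp_pos (-‖z‖ ^ 2)
    rw [norm_mul, norm_mul, RCLike.norm_conj, Complex.norm_real, Real.norm_of_nonneg he.le]
    simp only [Pi.add_apply]
    have h3 : ‖u z‖ * ‖v z‖ ≤ ‖u z‖ ^ 2 + ‖v z‖ ^ 2 := by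
      nlinarith [sq_nonneg (‖u z‖ - ‖v z‖), sq_nonneg (‖u z‖), sq_nonneg (‖v z‖)]
    nlinarith

theorem integral_self (u : SegalBargmann) :
    ∫ z : ℂ, conj (u z) * u z * (Real.exp (-‖z‖ ^ 2) : ℂ)
      = ((∫ z : ℂ, ‖u z‖ ^ 2 * Real.exp (-‖z‖ ^ 2) : ℝ) : ℂ) := by
  rw [← integral_complex_ofReal]
  refine integral_congr_ae (ae_of_all _ fun z => ?_)
  simp only [Complex.conj_mul']
  push_cast
  rfl

/-- The inner product `∫ u(z) \overline{v(z)} e^{-|z|²} dλ(z)`; as everywhere in Mathlib, the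
conjugated factor is written first, `⟪v, u⟫`. -/
@[reducible] def core : InnerProductSpace.Core ℂ SegalBargmann where
  inner v u := ∫ z : ℂ, conj (v z) * u z * (Real.exp (-‖z‖ ^ 2) : ℂ)
  conj_inner_symm u v := by
    rw [← integral_conj]
    refine integral_congr_ae (ae_of_all _ fun z => ?_)
    simp only [map_mul, Complex.conj_conj, Complex.conj_ofReal]
    ring
  re_inner_nonneg u := by
    rw [integral_self]
    exact integral_nonneg fun z => by positivity
  add_left u v w := by
    rw [← integral_add (integrable_inner u w) (integrable_inner v w)]
    refine integral_congr_ae (ae_of_all _ fun z => ?_)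
    simp only [add_apply, map_add]
    ring
  smul_left u v c := by
    rw [← integral_const_mul]
    refine integral_congr_ae (ae_of_all _ fun z => ?_)
    simp only [smul_apply, map_mul]
    ring
  definite u hu := by
    rw [integral_self, Complex.ofReal_eq_zero] at hu
    have hc : Continuous fun z : ℂ => ‖u z‖ ^ 2 * Real.exp (-‖z‖ ^ 2) := by
      have h1 := u.continuous
      fun_prop
    rw [integral_eq_zero_iff_of_nonneg (fun z => by positivity) u.integrable_normSq,
      hc.ae_eq_iff_eq volume continuous_zero] at hu
    apply toFun_injective
    funext z
    have hz := congrFun hu z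
    simpa [(Real.exp_pos _).ne'] using hz

instance : NormedAddCommGroup SegalBargmann := core.toNormedAddCommGroup

instance : InnerProductSpace ℂ SegalBargmann := InnerProductSpace.ofCore core.toCore

theorem inner_def (v u : SegalBargmann) :
    inner ℂ v u = ∫ z : ℂ, conj (v z) * u z * (Real.exp (-‖z‖ ^ 2) : ℂ) := rfl

theorem norm_sq (u : SegalBargmann) :
    ‖u‖ ^ 2 = ∫ z : ℂ, ‖u z‖ ^ 2 * Real.exp (-‖z‖ ^ 2) := by
  rw [InnerProductSpace.norm_sq_eq_re_inner (𝕜 := ℂ), inner_def, integral_self]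
  rfl

/-- The mean value property over a disc of radius one. -/
theorem integral_ball_entire (f : ℂ → ℂ) (hf : Differentiable ℂ f) :
    ∫ z in Metric.ball (0 : ℂ) 1, f z = Real.pi * f 0 := by
  rw [← integral_indicator Metric.isOpen_ball.measurableSet,
    ← Complex.integral_comp_polarCoord_symm]
  have hcirc : ∀ r : ℝ, ∫ θ in Set.Ioo (-Real.pi) Real.pi, f (circleMap 0 r θ)
      = 2 * Real.pi * f 0 := by
    intro r
    have h1 := (hf.diffContOnCl (s := Metric.ball 0 |r|)).circleAverage
    rw [Real.circleAverage_def] at h1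
    have hper : Function.Periodic (fun θ => f (circleMap 0 r θ)) (2 * Real.pi) :=
      fun θ => by simp only [periodic_circleMap 0 r θ]
    have h2 := hper.intervalIntegral_add_eq 0 (-Real.pi)
    rw [zero_add, show -Real.pi + 2 * Real.pi = Real.pi by ring] at h2
    rw [h2, intervalIntegral.integral_of_le (by linarith [Real.pi_pos]),
      integral_Ioc_eq_integral_Ioo] at h1
    rw [← h1, Complex.real_smul]
    have := Complex.ofReal_ne_zero.2 Real.pi_ne_zero
    push_cast
    field_simp
  have hpol : ∀ p : ℝ × ℝ, Complex.polarCoord.symm p = circleMap 0 p.1 p.2 := by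
    intro p
    rw [Complex.polarCoord_symm_apply, circleMap, zero_add, Complex.exp_mul_I]
    push_cast
    rfl
  have hset : ∫ p in polarCoord.target, p.1 • (Metric.ball (0 : ℂ) 1).indicator f
        (Complex.polarCoord.symm p)
      = ∫ p in (Set.Ioo (0 : ℝ) 1) ×ˢ (Set.Ioo (-Real.pi) Real.pi),
          p.1 • f (circleMap 0 p.1 p.2) := by
    rw [← integral_indicator polarCoord.open_target.measurableSet,
      ← integral_indicator (measurableSet_Ioo.prod measurableSet_Ioo)]
    congr 1
    funext p
    rw [polarCoord_target]
    simp only [Set.indicator, Set.mem_prod, Set.mem_Ioi, Set.mem_Ioo, hpol, mem_ball_zero_iff,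
      norm_circleMap_zero]
    by_cases h0 : 0 < p.1
    · rw [abs_of_pos h0]
      by_cases h1 : p.1 < 1 <;> simp [h0, h1]
    · simp [h0]
  have hcont : Continuous fun p : ℝ × ℝ => p.1 • f (circleMap 0 p.1 p.2) := by
    have h1 := hf.continuous
    unfold circleMap
    fun_prop
  rw [hset, Measure.volume_eq_prod, setIntegral_prod]
  · simp only [integral_smul, hcirc]
    rw [integral_smul_const, ← integral_Ioc_eq_integral_Ioo,
      ← intervalIntegral.integral_of_le zero_le_one, integral_id, Complex.real_smul]
    push_cast
    ring
  · refine (hcont.continuousOn.integrableOn_compact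
      (isCompact_Icc.prod isCompact_Icc)).mono_set (t := Set.Icc (0 : ℝ) 1 ×ˢ
        Set.Icc (-Real.pi) Real.pi) ?_
    exact Set.prod_mono Set.Ioo_subset_Icc_self Set.Ioo_subset_Icc_self

/-- Point evaluations are bounded, uniformly on bounded sets. -/
theorem norm_apply_le (u : SegalBargmann) (c : ℂ) :
    ‖u c‖ ≤ Real.exp ((‖c‖ + 1) ^ 2) * ‖u‖ := by
  have h1 := integral_ball_entire (fun z => u (c + z) ^ 2)
    ((u.differentiable.comp (differentiable_id.const_add c)).pow 2)
  have hmaj : Integrable (fun z : ℂ => Real.exp ((‖c‖ + 1) ^ 2) *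
      (‖u (c + z)‖ ^ 2 * Real.exp (-‖c + z‖ ^ 2))) volume :=
    (u.integrable_normSq.comp_add_left c).const_mul _
  have h2 : ‖∫ z in Metric.ball (0 : ℂ) 1, u (c + z) ^ 2‖
      ≤ ∫ z in Metric.ball (0 : ℂ) 1, Real.exp ((‖c‖ + 1) ^ 2) *
          (‖u (c + z)‖ ^ 2 * Real.exp (-‖c + z‖ ^ 2)) := by
    refine norm_integral_le_of_norm_le hmaj.integrableOn ?_
    refine (ae_restrict_iff' Metric.isOpen_ball.measurableSet).2 (ae_of_all _ fun z hz => ?_)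
    rw [mem_ball_zero_iff] at hz
    have h3 : ‖c + z‖ ≤ ‖c‖ + 1 := (norm_add_le _ _).trans (by linarith)
    have h4 : 1 ≤ Real.exp ((‖c‖ + 1) ^ 2) * Real.exp (-‖c + z‖ ^ 2) := by
      rw [← Real.exp_add]
      apply Real.one_le_exp
      nlinarith [norm_nonneg (c + z), norm_nonneg c]
    rw [norm_pow]
    nlinarith [sq_nonneg ‖u (c + z)‖]
  have h5 : ∫ z in Metric.ball (0 : ℂ) 1, Real.exp ((‖c‖ + 1) ^ 2) *
          (‖u (c + z)‖ ^ 2 * Real.exp (-‖c + z‖ ^ 2))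
      ≤ Real.exp ((‖c‖ + 1) ^ 2) * ‖u‖ ^ 2 := by
    refine (setIntegral_le_integral hmaj (ae_of_all _ fun z => by positivity)).trans ?_
    rw [integral_const_mul, norm_sq,
      integral_add_left_eq_self (fun z => ‖u z‖ ^ 2 * Real.exp (-‖z‖ ^ 2)) c]
  rw [h1, norm_mul, Complex.norm_real, Real.norm_of_nonneg Real.pi_pos.le, norm_pow,
    add_zero] at h2
  have h6 : ‖u c‖ ^ 2 ≤ (Real.exp ((‖c‖ + 1) ^ 2) * ‖u‖) ^ 2 := by
    have h7 : 1 ≤ Real.exp ((‖c‖ + 1) ^ 2) := Real.one_le_exp (by positivity)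
    have h8 := Real.pi_gt_three
    have h9 : Real.exp ((‖c‖ + 1) ^ 2) * ‖u‖ ^ 2 ≤ (Real.exp ((‖c‖ + 1) ^ 2) * ‖u‖) ^ 2 := by
      rw [mul_pow]
      gcongr
      nlinarith
    nlinarith [sq_nonneg ‖u c‖]
  exact le_of_sq_le_sq h6 (by positivity)

/-- The Segal–Bargmann space is a Hilbert space. -/
instance : CompleteSpace SegalBargmann := by
  refine Metric.complete_of_cauchySeq_tendsto fun U hU => ?_
  rw [Metric.cauchySeq_iff] at hU
  have hpt : ∀ z, CauchySeq fun n => U n z := by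
    intro z
    rw [Metric.cauchySeq_iff]
    intro ε hε
    obtain ⟨N, hN⟩ := hU (ε / Real.exp ((‖z‖ + 1) ^ 2)) (by positivity)
    refine ⟨N, fun m hm n hn => ?_⟩
    have h1 := norm_apply_le (U m - U n) z
    have h2 := hN m hm n hn
    rw [dist_eq_norm, lt_div_iff₀ (Real.exp_pos _)] at h2
    rw [dist_eq_norm, ← sub_apply]
    linarith
  choose f hf using fun z => cauchySeq_tendsto_of_complete (hpt z)
  have hlu : TendstoLocallyUniformlyOn (fun n => (U n : ℂ → ℂ)) f atTop Set.univ := by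
    rw [tendstoLocallyUniformlyOn_iff_forall_isCompact isOpen_univ]
    intro K _ hK
    obtain ⟨R, hR⟩ := hK.isBounded.exists_norm_le
    rw [Metric.tendstoUniformlyOn_iff]
    intro ε hε
    have hR' : 0 < Real.exp ((|R| + 1) ^ 2) := Real.exp_pos _
    obtain ⟨N, hN⟩ := hU (ε / 2 / Real.exp ((|R| + 1) ^ 2)) (by positivity)
    filter_upwards [eventually_ge_atTop N] with n hn z hz
    have hlim : Tendsto (fun m => dist (U m z) (U n z)) atTop (𝓝 (dist (f z) (U n z))) :=
      (hf z).dist tendsto_const_nhds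
    refine lt_of_le_of_lt (le_of_tendsto hlim ?_) (half_lt_self hε)
    filter_upwards [eventually_ge_atTop N] with m hm
    have h1 := norm_apply_le (U m - U n) z
    have h2 := hN m hm n hn
    rw [dist_eq_norm, lt_div_iff₀ hR'] at h2
    rw [dist_eq_norm, ← sub_apply]
    have h3 : Real.exp ((‖z‖ + 1) ^ 2) ≤ Real.exp ((|R| + 1) ^ 2) := by
      gcongr
      exact (hR z hz).trans (le_abs_self R)
    nlinarith [norm_nonneg (U m - U n)]
  have hfd : Differentiable ℂ f := by
    rw [← differentiableOn_univ]
    exact hlu.differentiableOn (Eventually.of_forall fun n => (U n).differentiable.differentiableOn)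
      isOpen_univ
  have hkey : ∀ ε : ℝ, 0 < ε → ∃ N, ∀ n ≥ N,
      ∫⁻ z : ℂ, ENNReal.ofReal (‖U n z - f z‖ ^ 2 * Real.exp (-‖z‖ ^ 2))
        ≤ ENNReal.ofReal (ε ^ 2) := by
    intro ε hε
    obtain ⟨N, hN⟩ := hU ε hε
    refine ⟨N, fun n hn => ?_⟩
    have hlim : ∀ z : ℂ, Tendsto
        (fun m => ENNReal.ofReal (‖U n z - U m z‖ ^ 2 * Real.exp (-‖z‖ ^ 2))) atTop
        (𝓝 (ENNReal.ofReal (‖U n z - f z‖ ^ 2 * Real.exp (-‖z‖ ^ 2)))) := fun z =>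
      ENNReal.tendsto_ofReal
        ((((tendsto_const_nhds.sub (hf z)).norm).pow 2).mul tendsto_const_nhds)
    calc _ = ∫⁻ z : ℂ, liminf
          (fun m => ENNReal.ofReal (‖U n z - U m z‖ ^ 2 * Real.exp (-‖z‖ ^ 2))) atTop :=
          lintegral_congr fun z => (hlim z).liminf_eq.symm
      _ ≤ liminf (fun m => ∫⁻ z : ℂ,
          ENNReal.ofReal (‖U n z - U m z‖ ^ 2 * Real.exp (-‖z‖ ^ 2))) atTop := by
          refine lintegral_liminf_le fun m => ?_
          have h1 := (U n).continuous
          have h2 := (U m).continuous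
          exact (Continuous.measurable (((h1.sub h2).norm.pow 2).mul
            (by fun_prop))).ennreal_ofReal
      _ ≤ ENNReal.ofReal (ε ^ 2) := by
          refine liminf_le_of_frequently_le' (Eventually.frequently ?_)
          filter_upwards [eventually_ge_atTop N] with m hm
          have h1 := (U n - U m).integrable_normSq
          have h2 := norm_sq (U n - U m)
          simp only [sub_apply] at h1 h2
          rw [← ofReal_integral_eq_lintegral_ofReal h1 (ae_of_all _ fun z => by positivity), ← h2]
          have h3 := hN n hn m hm
          rw [dist_eq_norm] at h3
          gcongr
  have hmem : ∀ n, (∫⁻ z : ℂ, ENNReal.ofReal (‖U n z - f z‖ ^ 2 * Real.exp (-‖z‖ ^ 2)) < ⊤) →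
      (fun z => U n z - f z) ∈ segalBargmannSubmodule := by
    intro n hn
    refine ⟨(U n).differentiable.sub hfd, ?_⟩
    have h1 := (U n).continuous
    have h2 := hfd.continuous
    refine ⟨(((h1.sub h2).norm.pow 2).mul (by fun_prop)).aestronglyMeasurable, ?_⟩
    rwa [hasFiniteIntegral_iff_ofReal (ae_of_all _ fun z => by positivity)]
  obtain ⟨N, hN⟩ := hkey 1 one_pos
  have hfm : f ∈ segalBargmannSubmodule := by
    have h1 := segalBargmannSubmodule.sub_mem (U N).coe_mem
      (hmem N ((hN N le_rfl).trans_lt ENNReal.ofReal_lt_top))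
    convert h1 using 1
    funext z
    simp
  refine ⟨mk f hfm, Metric.tendsto_atTop.2 fun ε hε => ?_⟩
  obtain ⟨M, hM⟩ := hkey (ε / 2) (half_pos hε)
  refine ⟨M, fun n hn => ?_⟩
  have h1 := norm_sq (U n - mk f hfm)
  have h2 := (U n - mk f hfm).integrable_normSq
  simp only [sub_apply, mk_apply] at h1 h2
  have h3 := hM n hn
  rw [← ofReal_integral_eq_lintegral_ofReal h2 (ae_of_all _ fun z => by positivity), ← h1,
    ENNReal.ofReal_le_ofReal_iff (by positivity)] at h3
  rw [dist_eq_norm]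
  exact (le_of_sq_le_sq h3 (by positivity)).trans_lt (half_lt_self hε)

end SegalBargmann

/-- The constant coefficient operator `p_m(u) = a_0 u + a_1 u' + ⋯ + a_m u^{(m)}`. -/
def polyDiff (m : ℕ) (a : ℕ → ℂ) (u : ℂ → ℂ) : ℂ → ℂ :=
  fun z => ∑ k ∈ Finset.range (m + 1), a k * iteratedDeriv k u z

theorem polyDiff_add (m : ℕ) (a : ℕ → ℂ) {u v : ℂ → ℂ} (hu : Differentiable ℂ u)
    (hv : Differentiable ℂ v) : polyDiff m a (u + v) = polyDiff m a u + polyDiff m a v := by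
  funext z
  simp only [polyDiff, Pi.add_apply, ← Finset.sum_add_distrib]
  refine Finset.sum_congr rfl fun k _ => ?_
  rw [iteratedDeriv_add hu.contDiff.contDiffAt hv.contDiff.contDiffAt, mul_add]

theorem polyDiff_smul (m : ℕ) (a : ℕ → ℂ) (c : ℂ) {u : ℂ → ℂ} (hu : Differentiable ℂ u) :
    polyDiff m a (c • u) = c • polyDiff m a u := by
  funext z
  simp only [polyDiff, Pi.smul_apply, smul_eq_mul, Finset.mul_sum]
  refine Finset.sum_congr rfl fun k _ => ?_
  rw [iteratedDeriv_const_smul hu.contDiff.contDiffAt, smul_eq_mul]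
  ring

/-- The unbounded operator `D u = p_m(u) dz` with its maximal domain
`{u ∈ A² : p_m(u) ∈ A²}`. A `(1,0)`-form `f dz` with coefficient in `A²` has the norm of `f`,
and is identified with its coefficient `f`. -/
def opD (m : ℕ) (a : ℕ → ℂ) : SegalBargmann →ₗ.[ℂ] SegalBargmann where
  domain :=
    { carrier := {u | polyDiff m a u ∈ segalBargmannSubmodule}
      zero_mem' := by
        have h : polyDiff m a (0 : ℂ → ℂ) = 0 := by
          have := polyDiff_smul m a 0 (differentiable_const (𝕜 := ℂ) (E := ℂ) (0 : ℂ))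
          rw [zero_smul, zero_smul] at this
          exact this
        rw [Set.mem_ofPred_eq, map_zero, h]
        exact segalBargmannSubmodule.zero_mem
      add_mem' := by
        intro u v hu hv
        rw [Set.mem_ofPred_eq] at hu hv ⊢
        rw [map_add, polyDiff_add m a u.differentiable v.differentiable]
        exact segalBargmannSubmodule.add_mem hu hv
      smul_mem' := by
        intro c u hu
        rw [Set.mem_ofPred_eq] at hu ⊢
        rw [map_smul, polyDiff_smul m a c u.differentiable]
        exact segalBargmannSubmodule.smul_mem c hu }
  toFun :=
    { toFun := fun u => SegalBargmann.mk (polyDiff m a u.1) u.2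
      map_add' := fun u v => SegalBargmann.toFun_injective
        (polyDiff_add m a u.1.differentiable v.1.differentiable)
      map_smul' := fun c u => SegalBargmann.toFun_injective
        (polyDiff_smul m a c u.1.differentiable) }

/-- The Hilbert space adjoint `D*` of `D`. -/
def opDstar (m : ℕ) (a : ℕ → ℂ) : SegalBargmann →ₗ.[ℂ] SegalBargmann :=
  (opD m a).adjoint

/-- The box operator `D D*` with domain `{f ∈ dom(D*) : D* f ∈ dom(D)}`. -/
def boxD (m : ℕ) (a : ℕ → ℂ) : SegalBargmann →ₗ.[ℂ] SegalBargmann where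
  domain :=
    { carrier := {f | ∃ h : f ∈ (opDstar m a).domain, opDstar m a ⟨f, h⟩ ∈ (opD m a).domain}
      zero_mem' := by
        refine ⟨zero_mem _, ?_⟩
        have h : opDstar m a ⟨0, zero_mem _⟩ = 0 := (opDstar m a).map_zero
        rw [h]
        exact zero_mem _
      add_mem' := by
        rintro f g ⟨hf, hf'⟩ ⟨hg, hg'⟩
        refine ⟨add_mem hf hg, ?_⟩
        have h : opDstar m a ⟨f + g, add_mem hf hg⟩
            = opDstar m a ⟨f, hf⟩ + opDstar m a ⟨g, hg⟩ :=
          (opDstar m a).map_add ⟨f, hf⟩ ⟨g, hg⟩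
        rw [h]
        exact add_mem hf' hg'
      smul_mem' := by
        rintro c f ⟨hf, hf'⟩
        refine ⟨Submodule.smul_mem _ c hf, ?_⟩
        have h : opDstar m a ⟨c • f, Submodule.smul_mem _ c hf⟩ = c • opDstar m a ⟨f, hf⟩ :=
          (opDstar m a).map_smul c ⟨f, hf⟩
        rw [h]
        exact Submodule.smul_mem _ c hf' }
  toFun :=
    { toFun := fun f => opD m a ⟨opDstar m a ⟨f.1, f.2.1⟩, f.2.2⟩
      map_add' := fun f g => by
        rw [← LinearPMap.map_add]
        congr 1
        exact Subtype.ext ((opDstar m a).map_add ⟨f.1, f.2.1⟩ ⟨g.1, g.2.1⟩)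
      map_smul' := fun c f => by
        rw [RingHom.id_apply, ← LinearPMap.map_smul]
        congr 1
        exact Subtype.ext ((opDstar m a).map_smul c ⟨f.1, f.2.1⟩) }

/-- The kernel of `D`, a subspace of the Segal–Bargmann space. -/
def kerD (m : ℕ) (a : ℕ → ℂ) : Submodule ℂ SegalBargmann :=
  (LinearMap.ker (opD m a).toFun).map (opD m a).domain.subtype

/-- The image of `D*`, a subspace of the Segal–Bargmann space. -/
def imDstar (m : ℕ) (a : ℕ → ℂ) : Submodule ℂ SegalBargmann :=
  LinearMap.range (opDstar m a).toFun

end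

/-! On the Segal–Bargmann space, differentiation and multiplication by `z` are adjoint to each
other, so `D*` is multiplication by the conjugate polynomial `q = ∑ \overline{a_k} z^k`, which is
not zero because `a_m ≠ 0`. Multiplication by `q` is bounded below: away from a large disc `|q|` is
at least some `δ > 0`, and inside the disc the maximum principle controls `f` by its values on the
circle, where `f = h / q` and point evaluations of `h` are bounded (`exists_pos_mul_norm_le_norm`).

The rest is Hilbert space theory. The closed operator `D*` has closed range and a bounded left
inverse `B` that vanishes on `(im D*)ᗮ`. Formally `B*` inverts `D` from the right with values in `im
D*`, hence `N = B B*` inverts `D D*` and `D* N = B*` is the canonical solution operator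
(`exists_inverse_comp_adjoint`). This needs `D** ⊆ D`, which holds because the domain of `D` is
maximal (`opD_of_inner_opDstar`).

Both facts about adjoints come from testing against monomials: the inner product of `u` with `z^n`
is `π u^{(n)}(0)` (`inner_monomial_left`), so identities of inner products become identities of
Taylor coefficients. -/

namespace LinearPMap

/-! ### Closed operators that are bounded below -/

variable {𝕜 E F : Type*} [RCLike 𝕜] [NormedAddCommGroup E] [InnerProductSpace 𝕜 E]
  [NormedAddCommGroup F] [InnerProductSpace 𝕜 F] [CompleteSpace F]

/-- A closed operator that is bounded below has closed range. -/
theorem IsClosed.isClosed_range {S : F →ₗ.[𝕜] E} (hS : S.IsClosed) {c : ℝ} (hc : 0 < c)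
    (hbd : ∀ g : S.domain, c * ‖(g : F)‖ ≤ ‖S g‖) :
    _root_.IsClosed (LinearMap.range S.toFun : Set E) := by
  refine isSeqClosed_iff_isClosed.1 fun y h hy hlim => ?_
  choose g hg using hy
  have hcau : CauchySeq fun n => (g n : F) := by
    rw [Metric.cauchySeq_iff]
    intro ε hε
    obtain ⟨N, hN⟩ := Metric.cauchySeq_iff.1 hlim.cauchySeq (c * ε) (by positivity)
    refine ⟨N, fun m hm n hn => ?_⟩
    have h1 := hN m hm n hn
    have h2 := hbd (g m - g n)
    rw [S.map_sub] at h2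
    rw [← hg m, ← hg n, dist_eq_norm] at h1
    rw [dist_eq_norm]
    exact lt_of_mul_lt_mul_left (h2.trans_lt h1) hc.le
  obtain ⟨f, hf⟩ := cauchySeq_tendsto_of_complete hcau
  have hmem : ((f, h) : F × E) ∈ (S.graph : Set (F × E)) := by
    refine hS.mem_of_tendsto (hf.prodMk_nhds hlim) (Eventually.of_forall fun n => ?_)
    rw [← hg n]
    exact S.mem_graph (g n)
  obtain ⟨x, -, hx⟩ := (S.mem_graph_iff).1 hmem
  exact ⟨x, hx⟩

variable [CompleteSpace E]

/-- A closed operator `S` that is bounded below has a bounded left inverse `B` that vanishes on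
the orthogonal complement of the range. -/
theorem IsClosed.exists_leftInverse {S : F →ₗ.[𝕜] E} (hS : S.IsClosed) {c : ℝ} (hc : 0 < c)
    (hbd : ∀ g : S.domain, c * ‖(g : F)‖ ≤ ‖S g‖) :
    ∃ B : E →L[𝕜] F, (∀ g : S.domain, B (S g) = g) ∧
      (∀ u ∈ (LinearMap.range S.toFun)ᗮ, B u = 0) ∧
      ∀ u ∈ LinearMap.range S.toFun, ∃ h : B u ∈ S.domain, S ⟨B u, h⟩ = u := by
  set R := LinearMap.range S.toFun with hR
  have : CompleteSpace R := (hS.isClosed_range hc hbd).completeSpace_coe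
  have hinj : Function.Injective S.toFun := by
    rw [← LinearMap.ker_eq_bot, LinearMap.ker_eq_bot']
    intro g hg
    have h1 := hbd g
    change S g = 0 at hg
    rw [hg, norm_zero] at h1
    exact Subtype.ext (norm_le_zero_iff.1 (nonpos_of_mul_nonpos_right h1 hc))
  let e := LinearEquiv.ofInjective S.toFun hinj
  let L : R →L[𝕜] F := (S.domain.subtype ∘ₗ e.symm.toLinearMap).mkContinuous c⁻¹ fun y => by
    have h1 := hbd (e.symm y)
    have h2 : S (e.symm y) = y := congrArg Subtype.val (e.apply_symm_apply y)
    rw [h2] at h1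
    rw [inv_mul_eq_div, le_div_iff₀ hc, mul_comm]
    exact h1
  have hL : ∀ g : S.domain, ∀ h : S g ∈ R, L ⟨S g, h⟩ = g := fun g h =>
    congrArg Subtype.val (e.symm_apply_apply g)
  have hP : ∀ u (h : u ∈ R), R.orthogonalProjectionOnto u = ⟨u, h⟩ := fun u h =>
    Submodule.orthogonalProjectionOnto_mem_subspace_eq_self (⟨u, h⟩ : R)
  have hB : ∀ g : S.domain, (L ∘L R.orthogonalProjectionOnto) (S g) = g := fun g => by
    rw [ContinuousLinearMap.comp_apply, hP (S g) ⟨g, rfl⟩]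
    exact hL g _
  refine ⟨L ∘L R.orthogonalProjectionOnto, hB, fun u hu => ?_, ?_⟩
  · rw [ContinuousLinearMap.comp_apply,
      Submodule.orthogonalProjectionOnto_apply_of_mem_orthogonal hu, _root_.map_zero]
  · rintro _ ⟨g, rfl⟩
    have h1 : (L ∘L R.orthogonalProjectionOnto) (S.toFun g) = g := hB g
    rw [h1]
    exact ⟨g.2, rfl⟩

/-- If `T` is densely defined, equal to its second adjoint, and `T†` is bounded below, then
`T T†` has the bounded inverse `B B*`, where `B` is a left inverse of `T†`. -/
theorem exists_inverse_comp_adjoint {T : E →ₗ.[𝕜] F} (hT : Dense (T.domain : Set E))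
    (hbi : ∀ (u : E) (α : F), (∀ g : T.adjoint.domain, inner 𝕜 u (T.adjoint g) = inner 𝕜 α g) →
      ∃ h : u ∈ T.domain, T ⟨u, h⟩ = α)
    {c : ℝ} (hc : 0 < c) (hbd : ∀ g : T.adjoint.domain, c * ‖(g : F)‖ ≤ ‖T.adjoint g‖) :
    ∃ (N : F →L[𝕜] F) (A : F →L[𝕜] E),
      (∀ α : F, ∃ (h : N α ∈ T.adjoint.domain), T.adjoint ⟨N α, h⟩ = A α) ∧
      (∀ α : F, ∃ (h : A α ∈ T.domain), T ⟨A α, h⟩ = α) ∧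
      (∀ (f : T.adjoint.domain) (h : T.adjoint f ∈ T.domain), N (T ⟨T.adjoint f, h⟩) = f) ∧
      ((LinearMap.ker T.toFun).map T.domain.subtype)ᗮ = LinearMap.range T.adjoint.toFun := by
  have hcl : T.adjoint.IsClosed := adjoint_isClosed hT
  have hfa := adjoint_isFormalAdjoint hT
  obtain ⟨B, hB, hB0, hBr⟩ := hcl.exists_leftInverse hc hbd
  set R := LinearMap.range T.adjoint.toFun with hR
  have : CompleteSpace R := (hcl.isClosed_range hc hbd).completeSpace_coe
  -- Since `B` vanishes on `Rᗮ`, the image of `B*` is orthogonal to `Rᗮ`, and `Rᗮᗮ = R` because `R`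
  -- is closed.
  have hAR : ∀ α, B.adjoint α ∈ R := fun α => by
    rw [← R.orthogonal_orthogonal, Submodule.mem_orthogonal]
    intro u hu
    rw [ContinuousLinearMap.adjoint_inner_right, hB0 u hu, inner_zero_left]
  refine ⟨B ∘L B.adjoint, B.adjoint, fun α => hBr _ (hAR α), fun α => hbi _ _ fun g => ?_,
    fun f h => ?_, le_antisymm ?_ ?_⟩
  -- `(B*α, T†g) = (α, B T†g) = (α, g)`, so `hbi` puts `B*α` in the domain of `T` and gives `T B*α =
  -- α`.
  · rw [ContinuousLinearMap.adjoint_inner_left, hB]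
  -- Tested against `v = v₁ + v₂` with `v₁ ∈ R` and `v₂ ∈ Rᗮ`: both sides kill `v₂`, and on `v₁ = T†
  -- B v₁` the identity is the adjoint relation between `T` and `T†`.
  · have h1 : B.adjoint (T ⟨T.adjoint f, h⟩) = T.adjoint f := by
      refine ext_inner_right 𝕜 fun v => ?_
      rw [ContinuousLinearMap.adjoint_inner_left]
      obtain ⟨v₁, h₁, v₂, h₂, rfl⟩ := R.exists_add_mem_mem_orthogonal v
      obtain ⟨h3, h4⟩ := hBr v₁ h₁
      have h6 : inner 𝕜 (T.adjoint f) v₂ = 0 :=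
        Submodule.inner_right_of_mem_orthogonal (K := R) ⟨f, rfl⟩ h₂
      rw [_root_.map_add, hB0 v₂ h₂, add_zero, inner_add_right, h6, add_zero]
      have h5 := hfa.symm ⟨T.adjoint f, h⟩ ⟨B v₁, h3⟩
      rw [h4] at h5
      exact h5
    rw [ContinuousLinearMap.comp_apply, h1, hB]
  -- It suffices that `Rᗮ` lies in the kernel of `T`, which is `hbi` with `α = 0`.
  · rw [← R.orthogonal_orthogonal]
    refine Submodule.orthogonal_le fun u hu => ?_
    obtain ⟨h, h0⟩ := hbi u 0 fun g => by
      rw [inner_zero_left]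
      exact Submodule.inner_left_of_mem_orthogonal (K := R) ⟨g, rfl⟩ hu
    exact ⟨⟨u, h⟩, h0, rfl⟩
  · rintro _ ⟨g, rfl⟩
    rw [Submodule.mem_orthogonal]
    rintro _ ⟨u, hu, rfl⟩
    have h1 := hfa.symm u g
    have h2 : T u = 0 := hu
    rw [h2, inner_zero_left] at h1
    exact h1.symm

end LinearPMap

/-! ### Polar coordinates and Gaussian integrals -/

theorem Complex.polarCoord_symm_eq_circleMap (p : ℝ × ℝ) :
    Complex.polarCoord.symm p = circleMap 0 p.1 p.2 := by
  rw [Complex.polarCoord_symm_apply, circleMap, zero_add, Complex.exp_mul_I]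
  push_cast
  rfl

/-- Integration of a continuous integrable function on the plane over circles. -/
theorem Complex.integral_eq_integral_circleMap {g : ℂ → ℂ} (hg : Continuous g)
    (hi : Integrable g) :
    ∫ z, g z = ∫ r in Set.Ioi (0 : ℝ), r • ∫ θ in Set.Ioo (-Real.pi) Real.pi,
      g (circleMap 0 r θ) := by
  have hcont : Continuous fun p : ℝ × ℝ => p.1 • g (circleMap 0 p.1 p.2) := by
    unfold circleMap
    fun_prop
  have hint : IntegrableOn (fun p : ℝ × ℝ => p.1 • g (circleMap 0 p.1 p.2))
      (Set.Ioi (0 : ℝ) ×ˢ Set.Ioo (-Real.pi) Real.pi) := by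
    refine ⟨hcont.aestronglyMeasurable, ?_⟩
    -- Fubini needs integrability in polar coordinates; the change of variables for the integral of
    -- the norm, Jacobian `p.1` included, transfers finiteness from the plane.
    have h1 := Complex.lintegral_comp_polarCoord_symm fun z => ‖g z‖ₑ
    rw [polarCoord_target] at h1
    have h2 := hi.2
    rw [HasFiniteIntegral, ← h1] at h2
    rw [HasFiniteIntegral]
    refine lt_of_eq_of_lt ?_ h2
    refine setLIntegral_congr_fun (measurableSet_Ioi.prod measurableSet_Ioo) fun p hp => ?_
    have h3 : 0 < p.1 := hp.1
    simp only [Complex.polarCoord_symm_eq_circleMap, enorm_smul, smul_eq_mul,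
      Real.enorm_eq_ofReal h3.le]
  rw [← Complex.integral_comp_polarCoord_symm, polarCoord_target]
  simp only [Complex.polarCoord_symm_eq_circleMap]
  rw [Measure.volume_eq_prod] at hint ⊢
  rw [setIntegral_prod _ hint]
  simp only [integral_smul]

/-- Cauchy's formula for the Taylor coefficients, against powers of the conjugate. -/
theorem integral_conj_pow_mul_circleMap {f : ℂ → ℂ} (hf : Differentiable ℂ f) (n : ℕ) {r : ℝ}
    (hr : 0 < r) :
    ∫ θ in Set.Ioo (-Real.pi) Real.pi, conj (circleMap 0 r θ) ^ n * f (circleMap 0 r θ)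
      = (r ^ (2 * n) : ℝ) * (2 * Real.pi / n.factorial * iteratedDeriv n f 0) := by
  have h1 := (hf.differentiableOn (s := Metric.closedBall 0 r)
    ).circleIntegral_one_div_sub_center_pow_smul hr n
  have hper : Function.Periodic (fun θ => conj (circleMap 0 r θ) ^ n * f (circleMap 0 r θ))
      (2 * Real.pi) := fun θ => by simp only [periodic_circleMap 0 r θ]
  have h2 := hper.intervalIntegral_add_eq 0 (-Real.pi)
  rw [zero_add, show -Real.pi + 2 * Real.pi = Real.pi by ring] at h2
  rw [← integral_Ioc_eq_integral_Ioo,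
    ← intervalIntegral.integral_of_le (by linarith [Real.pi_pos]), ← h2]
  -- On the circle `\overline{w} = r² / w` and `dw = i w dθ`, so the integrand becomes that of
  -- Cauchy's formula for the `n`-th derivative, up to the factor `r^{2n} / i`.
  have h3 : ∀ θ : ℝ, conj (circleMap 0 r θ) ^ n * f (circleMap 0 r θ)
      = ((r ^ (2 * n) : ℝ) * Complex.I⁻¹) * (deriv (circleMap 0 r) θ •
        ((1 / (circleMap 0 r θ - 0) ^ (n + 1)) • f (circleMap 0 r θ))) := by
    intro θ
    have h4 : circleMap 0 r θ ≠ 0 := circleMap_ne_center hr.ne'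
    have h5 : conj (circleMap 0 r θ) * circleMap 0 r θ = (r : ℂ) ^ 2 := by
      rw [Complex.conj_mul', norm_circleMap_zero, abs_of_pos hr]
    have h6 : conj (circleMap 0 r θ) = (r : ℂ) ^ 2 / circleMap 0 r θ := by
      rw [eq_div_iff h4, h5]
    rw [deriv_circleMap, h6, div_pow]
    simp only [smul_eq_mul, sub_zero]
    generalize circleMap 0 r θ = w at h4
    have := Complex.I_ne_zero
    push_cast
    field_simp
    ring
  simp only [h3]
  rw [intervalIntegral.integral_const_mul]
  rw [circleIntegral] at h1
  rw [h1, smul_eq_mul]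
  have := Complex.I_ne_zero
  field_simp

/-- Half of the Gaussian absorbs the power: `t^n / n! ≤ e^t` at `t = |z|² / 2` leaves the integrable
majorant `2^n n! e^{-|z|²/2}`. -/
theorem integrable_pow_mul_exp_neg_sq (n : ℕ) :
    Integrable fun z : ℂ => ‖z‖ ^ (2 * n) * Real.exp (-‖z‖ ^ 2) := by
  have h1 := GaussianFourier.integrable_cexp_neg_mul_sq_norm_add (V := ℂ) (b := 1 / 2)
    (by norm_num) 0 0
  refine (h1.norm.const_mul (2 ^ n * n.factorial)).mono'
    (Continuous.aestronglyMeasurable (by fun_prop)) (ae_of_all _ fun z => ?_)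
  rw [Complex.norm_exp, Real.norm_of_nonneg (by positivity)]
  have h2 := Real.pow_div_factorial_le_exp (‖z‖ ^ 2 / 2) (by positivity) n
  rw [div_le_iff₀ (by positivity), div_pow, div_le_iff₀ (by positivity), ← pow_mul] at h2
  have h3 : (-(1 / 2 : ℂ) * (‖z‖ : ℂ) ^ 2 + 0 * ((inner ℝ (0 : ℂ) z : ℝ) : ℂ)).re
      = -(‖z‖ ^ 2 / 2) := by
    rw [← Complex.ofReal_re (-(‖z‖ ^ 2 / 2))]
    congr 1
    push_cast
    ring
  rw [h3]
  have h4 : Real.exp (-‖z‖ ^ 2) = Real.exp (-(‖z‖ ^ 2 / 2)) * Real.exp (-(‖z‖ ^ 2 / 2)) := by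
    rw [← Real.exp_add]; ring_nf
  have h5 : Real.exp (‖z‖ ^ 2 / 2) * Real.exp (-(‖z‖ ^ 2 / 2)) = 1 := by
    rw [← Real.exp_add]; simp
  have h6 := Real.exp_pos (-(‖z‖ ^ 2 / 2))
  calc _ ≤ (Real.exp (‖z‖ ^ 2 / 2) * n.factorial * 2 ^ n) * Real.exp (-‖z‖ ^ 2) := by gcongr
    _ = (2 ^ n * n.factorial) * ((Real.exp (‖z‖ ^ 2 / 2) * Real.exp (-(‖z‖ ^ 2 / 2))) *
        Real.exp (-(‖z‖ ^ 2 / 2))) := by rw [h4]; ring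
    _ ≤ _ := by rw [h5, one_mul]

theorem integral_Ioi_odd_pow_mul_exp_neg_sq (n : ℕ) :
    ∫ r in Set.Ioi (0 : ℝ), r ^ (2 * n + 1) * Real.exp (-r ^ 2) = n.factorial / 2 := by
  have h1 := integral_rpow_mul_exp_neg_rpow (p := 2) (q := (2 * n + 1 : ℕ)) (by norm_num)
    (by have : (0 : ℝ) ≤ ((2 * n + 1 : ℕ) : ℝ) := Nat.cast_nonneg _
        linarith)
  have h2 : (((2 * n + 1 : ℕ) : ℝ) + 1) / 2 = n + 1 := by push_cast; ring
  rw [h2, Real.Gamma_nat_eq_factorial] at h1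
  simp only [Real.rpow_natCast, Real.rpow_ofNat] at h1
  rw [h1]
  ring

/-! ### Monomials and Taylor coefficients -/

namespace SegalBargmann

/-- The monomial `z ↦ z ^ n` as an element of the Segal–Bargmann space. -/
noncomputable def monomial (n : ℕ) : SegalBargmann :=
  mk (fun z => z ^ n) ⟨by fun_prop, by
    simpa only [norm_pow, ← pow_mul, mul_comm n] using integrable_pow_mul_exp_neg_sq n⟩

theorem monomial_apply (n : ℕ) (z : ℂ) : monomial n z = z ^ n := rfl

/-- The inner product with a monomial is a Taylor coefficient. -/
theorem inner_monomial_left (n : ℕ) (u : SegalBargmann) :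
    inner ℂ (monomial n) u = Real.pi * iteratedDeriv n u 0 := by
  have hc := u.continuous
  have hcont : Continuous fun z : ℂ =>
      conj (monomial n z) * u z * (Real.exp (-‖z‖ ^ 2) : ℂ) := by
    simp only [monomial_apply]
    fun_prop
  rw [inner_def, Complex.integral_eq_integral_circleMap hcont (integrable_inner _ _)]
  have h1 : ∀ r ∈ Set.Ioi (0 : ℝ), (r • ∫ θ in Set.Ioo (-Real.pi) Real.pi,
      conj (monomial n (circleMap 0 r θ)) * u (circleMap 0 r θ) *
        (Real.exp (-‖circleMap 0 r θ‖ ^ 2) : ℂ))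
      = ((r ^ (2 * n + 1) * Real.exp (-r ^ 2) : ℝ) : ℂ) *
        (2 * Real.pi / n.factorial * iteratedDeriv n u 0) := by
    intro r hr
    have hr' : 0 < r := hr
    simp only [monomial_apply, norm_circleMap_zero, sq_abs, map_pow]
    rw [integral_mul_const, integral_conj_pow_mul_circleMap u.differentiable n hr',
      Complex.real_smul]
    push_cast
    ring
  -- The radial integral `n!/2` cancels against the angular factor `2π/n!`, leaving `π`.
  rw [setIntegral_congr_fun measurableSet_Ioi h1, integral_mul_const, integral_complex_ofReal,
    integral_Ioi_odd_pow_mul_exp_neg_sq]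
  have : (n.factorial : ℂ) ≠ 0 := mod_cast n.factorial_ne_zero
  push_cast
  field_simp

theorem ext_iteratedDeriv {f g : ℂ → ℂ} (hf : Differentiable ℂ f) (hg : Differentiable ℂ g)
    (h : ∀ n, iteratedDeriv n f 0 = iteratedDeriv n g 0) : f = g := by
  funext z
  rw [← Complex.taylorSeries_eq_of_entire' 0 z hf, ← Complex.taylorSeries_eq_of_entire' 0 z hg]
  simp only [h]

/-- The monomials span a dense subspace. -/
theorem dense_of_monomial_mem {K : Submodule ℂ SegalBargmann} (hK : ∀ n, monomial n ∈ K) :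
    Dense (K : Set SegalBargmann) := by
  rw [Submodule.dense_iff_topologicalClosure_eq_top, Submodule.topologicalClosure_eq_top_iff,
    Submodule.eq_bot_iff]
  intro u hu
  refine toFun_injective (ext_iteratedDeriv u.differentiable (differentiable_const 0) fun n => ?_)
  have h1 := Submodule.inner_right_of_mem_orthogonal (hK n) hu
  rw [inner_monomial_left, mul_eq_zero, or_iff_right (by exact_mod_cast Real.pi_ne_zero)] at h1
  rw [h1]
  simp

end SegalBargmann

/-! ### Polynomials and derivatives of entire functions -/

/-- A nonconstant polynomial tends to infinity in norm, and a nonzero constant is its own lower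
bound. -/
theorem Polynomial.exists_pos_le_norm_eval {q : Polynomial ℂ} (hq : q ≠ 0) :
    ∃ δ > 0, ∃ R > 0, ∀ z : ℂ, R ≤ ‖z‖ → δ ≤ ‖q.eval z‖ := by
  rcases le_or_gt q.degree 0 with hd | hd
  · rw [Polynomial.eq_C_of_degree_le_zero hd] at hq ⊢
    have h0 : q.coeff 0 ≠ 0 := fun h => hq (by rw [h, Polynomial.C_0])
    exact ⟨‖q.coeff 0‖, norm_pos_iff.2 h0, 1, one_pos, fun z _ => by rw [Polynomial.eval_C]⟩
  · have h1 := q.tendsto_norm_atTop hd tendsto_norm_cobounded_atTop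
    have h2 := h1.eventually_ge_atTop 1
    rw [← comap_norm_atTop, eventually_comap] at h2
    obtain ⟨R, hR⟩ := eventually_atTop.1 h2
    exact ⟨1, one_pos, max R 1, by positivity,
      fun z hz => hR ‖z‖ ((le_max_left _ _).trans hz) z rfl⟩

/-- At `0` the Leibniz rule leaves only the term in which `z^k` is differentiated exactly `k` times.
For `k > n` there is no such term and `n.descFactorial k = 0`, so the truncated subtraction `n - k`
does no harm. -/
theorem iteratedDeriv_pow_mul_zero {f : ℂ → ℂ} (hf : Differentiable ℂ f) (n k : ℕ) :
    iteratedDeriv n (fun z => z ^ k * f z) 0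
      = n.descFactorial k * iteratedDeriv (n - k) f 0 := by
  rw [iteratedDeriv_fun_mul (by fun_prop) hf.contDiff.contDiffAt]
  simp only [iteratedDeriv_fun_pow_zero]
  rcases le_or_gt k n with h | h
  · rw [Finset.sum_eq_single k]
    · rw [if_pos rfl, Nat.descFactorial_eq_factorial_mul_choose]
      push_cast
      ring
    · intro i _ hi
      simp [hi]
    · intro hk
      exact absurd (Finset.mem_range.2 (by omega)) hk
  · rw [Nat.descFactorial_eq_zero_iff_lt.2 h, Nat.cast_zero, zero_mul]
    refine Finset.sum_eq_zero fun i hi => ?_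
    have : i ≠ k := by have := Finset.mem_range.1 hi; omega
    simp [this]

theorem differentiable_iteratedDeriv {f : ℂ → ℂ} (hf : Differentiable ℂ f) (k : ℕ) :
    Differentiable ℂ (iteratedDeriv k f) :=
  (hf.contDiff (n := ⊤)).differentiable_iteratedDeriv k (mod_cast WithTop.coe_lt_top _)

theorem differentiable_polyDiff (m : ℕ) (a : ℕ → ℂ) {f : ℂ → ℂ} (hf : Differentiable ℂ f) :
    Differentiable ℂ (polyDiff m a f) := by
  unfold polyDiff
  have := differentiable_iteratedDeriv hf
  fun_prop

theorem iteratedDeriv_polyDiff (m : ℕ) (a : ℕ → ℂ) {f : ℂ → ℂ} (hf : Differentiable ℂ f) (n : ℕ)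
    (z : ℂ) : iteratedDeriv n (polyDiff m a f) z
      = ∑ k ∈ Finset.range (m + 1), a k * iteratedDeriv (n + k) f z := by
  unfold polyDiff
  rw [iteratedDeriv_fun_sum fun k _ =>
    ((differentiable_iteratedDeriv hf k).const_mul (a k)).contDiff.contDiffAt]
  refine Finset.sum_congr rfl fun k _ => ?_
  rw [iteratedDeriv_const_mul_field]
  simp only [iteratedDeriv_eq_iterate, Function.iterate_add_apply]

/-- The symbol `∑ \overline{a_k} z^k` of the adjoint operator. -/
noncomputable def adjointSymbol (m : ℕ) (a : ℕ → ℂ) : Polynomial ℂ :=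
  ∑ k ∈ Finset.range (m + 1), Polynomial.C (conj (a k)) * Polynomial.X ^ k

theorem eval_adjointSymbol (m : ℕ) (a : ℕ → ℂ) (z : ℂ) :
    (adjointSymbol m a).eval z = ∑ k ∈ Finset.range (m + 1), conj (a k) * z ^ k := by
  simp [adjointSymbol, Polynomial.eval_finsetSum]

theorem adjointSymbol_ne_zero {m : ℕ} {a : ℕ → ℂ} (ha : a m ≠ 0) : adjointSymbol m a ≠ 0 := by
  intro h
  have h1 := congrArg (Polynomial.coeff · m) h
  simp [adjointSymbol, Polynomial.finsetSum_coeff, Polynomial.coeff_X_pow, ha] at h1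

/-! ### The lower bound for multiplication, and the adjoint of `D` -/

namespace SegalBargmann

/-- Multiplication by a nonzero polynomial is bounded below on the Segal–Bargmann space. -/
theorem exists_pos_mul_norm_le_norm {q : Polynomial ℂ} (hq : q ≠ 0) :
    ∃ c > 0, ∀ f h : SegalBargmann, (∀ z, h z = q.eval z * f z) → c * ‖f‖ ≤ ‖h‖ := by
  obtain ⟨δ, hδ, R, hR, hqR⟩ := Polynomial.exists_pos_le_norm_eval hq
  -- On the circle `|z| = R`, `|f| ≤ δ⁻¹ |h|`, and the point evaluation bound `norm_apply_le` gives
  -- `|h| ≤ exp((R + 1)²) ‖h‖`.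
  set M := δ⁻¹ * Real.exp ((R + 1) ^ 2) with hM
  have hG : Integrable fun z : ℂ => Real.exp (-‖z‖ ^ 2) := by
    simpa using integrable_pow_mul_exp_neg_sq 0
  set G := ∫ z : ℂ, Real.exp (-‖z‖ ^ 2) with hGdef
  have hG0 : 0 ≤ G := integral_nonneg fun z => (Real.exp_pos _).le
  -- The two summands account for `‖z‖ ≥ R` and `‖z‖ ≤ R`; adding both majorants everywhere avoids
  -- splitting the integral.
  set K := δ⁻¹ ^ 2 + M ^ 2 * G with hK
  have hK0 : 0 < K := by positivity
  refine ⟨(√K)⁻¹, by positivity, fun f h hfh => ?_⟩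
  have hout : ∀ z : ℂ, R ≤ ‖z‖ → ‖f z‖ ≤ δ⁻¹ * ‖h z‖ := by
    intro z hz
    rw [hfh, norm_mul, inv_mul_eq_div, le_div_iff₀ hδ, mul_comm]
    exact mul_le_mul_of_nonneg_right (hqR z hz) (norm_nonneg _)
  have hin : ∀ z : ℂ, ‖z‖ ≤ R → ‖f z‖ ≤ M * ‖h‖ := by
    intro z hz
    -- Maximum principle: zeros of `q` inside the disc are harmless, since only the boundary values
    -- of `f` matter.
    refine Complex.norm_le_of_forall_mem_frontier_norm_le (U := Metric.ball 0 R)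
      Metric.isBounded_ball f.differentiable.diffContOnCl (fun w hw => ?_) ?_
    · rw [frontier_ball _ hR.ne', mem_sphere_zero_iff_norm] at hw
      refine (hout w hw.ge).trans ?_
      rw [hM, mul_assoc]
      have h1 := norm_apply_le h w
      rw [hw] at h1
      gcongr
    · rwa [closure_ball _ hR.ne', mem_closedBall_zero_iff]
  have hpt : ∀ z : ℂ, ‖f z‖ ^ 2 * Real.exp (-‖z‖ ^ 2)
      ≤ δ⁻¹ ^ 2 * (‖h z‖ ^ 2 * Real.exp (-‖z‖ ^ 2))
        + (M * ‖h‖) ^ 2 * Real.exp (-‖z‖ ^ 2) := by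
    intro z
    rw [← mul_assoc, ← add_mul, ← mul_pow]
    refine mul_le_mul_of_nonneg_right ?_ (Real.exp_pos _).le
    rcases le_total ‖z‖ R with hz | hz
    · exact (pow_le_pow_left₀ (norm_nonneg _) (hin z hz) 2).trans
        (le_add_of_nonneg_left (by positivity))
    · exact (pow_le_pow_left₀ (norm_nonneg _) (hout z hz) 2).trans
        (le_add_of_nonneg_right (by positivity))
  have hsq : ‖f‖ ^ 2 ≤ K * ‖h‖ ^ 2 := by
    rw [norm_sq f]
    refine (integral_mono f.integrable_normSq
      ((h.integrable_normSq.const_mul _).add (hG.const_mul _)) hpt).trans_eq ?_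
    rw [integral_add' (h.integrable_normSq.const_mul _) (hG.const_mul _), integral_const_mul,
      integral_const_mul, ← norm_sq h, ← hGdef, hK]
    ring
  rw [inv_mul_eq_div, div_le_iff₀ (by positivity)]
  refine le_of_sq_le_sq ?_ (by positivity)
  rw [mul_pow, Real.sq_sqrt hK0.le]
  linarith

theorem sum_apply {ι : Type*} (s : Finset ι) (u : ι → SegalBargmann) (z : ℂ) :
    (∑ i ∈ s, u i) z = ∑ i ∈ s, u i z := by
  rw [map_sum, Finset.sum_apply]

theorem inner_sum_monomial_left {ι : Type*} (s : Finset ι) (c : ι → ℂ) (e : ι → ℕ)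
    (u : SegalBargmann) : inner ℂ (∑ i ∈ s, c i • monomial (e i)) u
      = Real.pi * ∑ i ∈ s, conj (c i) * iteratedDeriv (e i) u 0 := by
  rw [sum_inner, Finset.mul_sum]
  refine Finset.sum_congr rfl fun i _ => ?_
  rw [inner_smul_left, inner_monomial_left]
  ring

theorem polyDiff_monomial (m : ℕ) (a : ℕ → ℂ) (n : ℕ) :
    polyDiff m a (monomial n) = (∑ k ∈ Finset.range (m + 1),
      (a k * n.descFactorial k) • monomial (n - k) : SegalBargmann) := by
  funext z
  rw [sum_apply]
  refine Finset.sum_congr rfl fun k _ => ?_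
  have h1 : (monomial n : ℂ → ℂ) = (· ^ n) := rfl
  rw [h1, iteratedDeriv_pow, smul_apply, monomial_apply]
  ring

theorem monomial_mem_domain (m : ℕ) (a : ℕ → ℂ) (n : ℕ) : monomial n ∈ (opD m a).domain := by
  change polyDiff m a (monomial n) ∈ segalBargmannSubmodule
  rw [polyDiff_monomial]
  exact coe_mem _

theorem opD_monomial (m : ℕ) (a : ℕ → ℂ) (n : ℕ) :
    opD m a ⟨monomial n, monomial_mem_domain m a n⟩
      = ∑ k ∈ Finset.range (m + 1), (a k * n.descFactorial k) • monomial (n - k) :=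
  toFun_injective (polyDiff_monomial m a n)

theorem dense_domain_opD (m : ℕ) (a : ℕ → ℂ) : Dense ((opD m a).domain : Set SegalBargmann) :=
  dense_of_monomial_mem (monomial_mem_domain m a)

/-- Both sides equal `π ∑ a_k u^{(n+k)}(0)`. The identity shows that `z^n` lies in the domain of
`D*` and identifies its image. -/
theorem inner_monomial_opD (m : ℕ) (a : ℕ → ℂ) (n : ℕ) (u : (opD m a).domain) :
    inner ℂ (∑ k ∈ Finset.range (m + 1), conj (a k) • monomial (n + k)) (u : SegalBargmann)
      = inner ℂ (monomial n) (opD m a u) := by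
  rw [inner_sum_monomial_left, inner_monomial_left]
  change _ = _ * iteratedDeriv n (polyDiff m a u) 0
  rw [iteratedDeriv_polyDiff m a (differentiable _)]
  simp only [Complex.conj_conj]

theorem monomial_mem_domain_opDstar (m : ℕ) (a : ℕ → ℂ) (n : ℕ) :
    monomial n ∈ (opDstar m a).domain :=
  LinearPMap.mem_adjoint_domain_of_exists _ ⟨_, inner_monomial_opD m a n⟩

theorem opDstar_monomial (m : ℕ) (a : ℕ → ℂ) (n : ℕ) :
    opDstar m a ⟨monomial n, monomial_mem_domain_opDstar m a n⟩
      = ∑ k ∈ Finset.range (m + 1), conj (a k) • monomial (n + k) :=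
  LinearPMap.adjoint_apply_eq (dense_domain_opD m a) _ (inner_monomial_opD m a n)

/-- The adjoint of `p(∂)` acts as multiplication by the conjugate polynomial. -/
theorem opDstar_apply (m : ℕ) (a : ℕ → ℂ) (f : (opDstar m a).domain) (z : ℂ) :
    opDstar m a f z = (adjointSymbol m a).eval z * (f : SegalBargmann) z := by
  have hf := differentiable (f : SegalBargmann)
  have hp : ∀ z, (adjointSymbol m a).eval z * (f : SegalBargmann) z
      = ∑ k ∈ Finset.range (m + 1), conj (a k) * (z ^ k * (f : SegalBargmann) z) := fun z => by
    simp only [eval_adjointSymbol, Finset.sum_mul, mul_assoc]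
  rw [hp]
  refine congrFun (ext_iteratedDeriv (g := fun z => ∑ k ∈ Finset.range (m + 1),
    conj (a k) * (z ^ k * (f : SegalBargmann) z)) (differentiable _) (by fun_prop)
    fun n => ?_) z
  -- The relation `(D z^n, f) = (z^n, D* f)`, in the convention with the conjugated factor first,
  -- expresses the `n`-th Taylor coefficient of `D* f` by those of `f`; the Leibniz rule gives the
  -- same value for `q f`.
  have h1 := (LinearPMap.adjoint_isFormalAdjoint (dense_domain_opD m a)).symm
    ⟨monomial n, monomial_mem_domain m a n⟩ f
  rw [opD_monomial, inner_sum_monomial_left] at h1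
  change _ = inner ℂ (monomial n) (opDstar m a f) at h1
  rw [inner_monomial_left] at h1
  rw [← mul_left_cancel₀ (by exact_mod_cast Real.pi_ne_zero) h1, iteratedDeriv_fun_sum fun k _ =>
    Differentiable.contDiff (by fun_prop) |>.contDiffAt]
  refine Finset.sum_congr rfl fun k _ => ?_
  rw [iteratedDeriv_const_mul_field, iteratedDeriv_pow_mul_zero hf, map_mul, Complex.conj_natCast,
    mul_assoc]

/-- The second adjoint of `p(∂)` is contained in `p(∂)`. -/
theorem opD_of_inner_opDstar (m : ℕ) (a : ℕ → ℂ) (u α : SegalBargmann)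
    (h : ∀ g : (opDstar m a).domain, inner ℂ u (opDstar m a g) = inner ℂ α (g : SegalBargmann)) :
    ∃ hu : u ∈ (opD m a).domain, opD m a ⟨u, hu⟩ = α := by
  -- Testing the hypothesis on `g = z^n` matches all derivatives at `0`. As the domain of `D` is
  -- maximal, this equality of entire functions already puts `u` in it.
  have heq : polyDiff m a u = α := by
    refine ext_iteratedDeriv (differentiable_polyDiff m a u.differentiable) α.differentiable
      fun n => ?_
    have h1 := congrArg conj (h ⟨monomial n, monomial_mem_domain_opDstar m a n⟩)
    rw [opDstar_monomial, inner_conj_symm, inner_conj_symm, inner_sum_monomial_left,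
      inner_monomial_left] at h1
    rw [iteratedDeriv_polyDiff m a u.differentiable,
      ← mul_left_cancel₀ (by exact_mod_cast Real.pi_ne_zero) h1]
    simp only [Complex.conj_conj]
  have hu : u ∈ (opD m a).domain := by
    change polyDiff m a u ∈ segalBargmannSubmodule
    rw [heq]
    exact α.coe_mem
  exact ⟨hu, toFun_injective heq⟩

end SegalBargmann

/-! ### The bounded inverse and the canonical solution -/

open SegalBargmann in
theorem theorem2p4 (m : ℕ) (a : ℕ → ℂ) (ha : a m ≠ 0) :
    ∃ N : SegalBargmann →L[ℂ] SegalBargmann,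
      (∀ α : SegalBargmann, ∃ h : N α ∈ (boxD m a).domain, boxD m a ⟨N α, h⟩ = α) ∧
      (∀ f : (boxD m a).domain, N (boxD m a f) = f) ∧
      (kerD m a)ᗮ = imDstar m a ∧
      ∃ C : ℝ, 0 < C ∧ ∀ α : SegalBargmann,
        ∃ (h : N α ∈ (opDstar m a).domain)
          (h' : opDstar m a ⟨N α, h⟩ ∈ (opD m a).domain),
          opD m a ⟨opDstar m a ⟨N α, h⟩, h'⟩ = α ∧
          opDstar m a ⟨N α, h⟩ ∈ (kerD m a)ᗮ ∧
          ‖opDstar m a ⟨N α, h⟩‖ ≤ C * ‖α‖ := by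
  obtain ⟨c, hc, hbd⟩ := exists_pos_mul_norm_le_norm (adjointSymbol_ne_zero ha)
  obtain ⟨N, A, hNA, hA, hN, hker⟩ := LinearPMap.exists_inverse_comp_adjoint
    (dense_domain_opD m a) (opD_of_inner_opDstar m a) hc
    fun g => hbd g _ (opDstar_apply m a g)
  have hcan : ∀ α : SegalBargmann, ∃ (h : N α ∈ (opDstar m a).domain)
      (h' : opDstar m a ⟨N α, h⟩ ∈ (opD m a).domain),
      opD m a ⟨opDstar m a ⟨N α, h⟩, h'⟩ = α ∧ opDstar m a ⟨N α, h⟩ = A α := by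
    intro α
    obtain ⟨h1, h2⟩ := hNA α
    obtain ⟨h3, h4⟩ := hA α
    have h5 : opDstar m a ⟨N α, h1⟩ = A α := h2
    refine ⟨h1, h5 ▸ h3, ?_, h5⟩
    simpa only [h5] using h4
  -- Since `D* N = A`, the norm of `A` bounds the solution; the added `1` only makes the constant
  -- positive.
  refine ⟨N, fun α => ?_, fun f => hN ⟨f, f.2.1⟩ f.2.2, hker, ‖A‖ + 1, by positivity,
    fun α => ?_⟩
  · obtain ⟨h, h', h1, -⟩ := hcan α
    exact ⟨⟨h, h'⟩, h1⟩
  · obtain ⟨h, h', h1, h2⟩ := hcan α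
    refine ⟨h, h', h1, ?_, ?_⟩
    · have h3 : (kerD m a)ᗮ = imDstar m a := hker
      rw [h3]
      exact ⟨_, rfl⟩
    · rw [h2]
      refine (A.le_opNorm α).trans ?_
      gcongr
      linarith
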